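/- Let $K$ be a non-archimedean local field with a non-archimedean absolute value $|\cdot|$ that defines its topology, $\mathcal V=\{|x|:x\in K^\times\}$, $\mathcal O=\{x\in K:|x|\le 1\}$, $B_r(a)=\{x\in K:|x-a|\le r\}$, and let $\mu$ be the Haar measure on $K$ with $\mu(\mathcal O)=1$. For $r\in\mathcal V$ write $H=\mathcal O/B_r(0)$ for the set of cosets of $B_r(0)$ contained in $\mathcal O$. A map $T:\mathcal O\to\mathcal O$ is \emph{locally scaling for $r$} if $\mathcal O$ is a finite union of balls of radius $r$ and there is a function $C:\mathcal O\to\mathbb R_{\ge 1}$ such that $|T(x)-T(y)|=C(x)\,|x-y|$ for all $x,y\in\mathcal O$ with $|x-y|\le r$. The function $C$ is then unique and constant on each coset $i\in H$, with value denoted $C(i)$; the \emph{associated transition matrix} of $T$ is the matrix $A:H\times H\to\mathbb R_{\ge0}$ with $A(i,j)=0$ if $i\cap T^{-1}(j)=\emptyset$, and $A(i,j)=\mu\bigl(B_{1/C(i)}(0)\bigr)$ otherwise. A map $T:\mathcal O\to\mathcal O$ is \emph{locally affine} if for each $x\in\mathcal O$ there are $s\in\mathcal V$ and $a,b\in K$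 such that $T(y)=ay+b$ for all $y\in\mathcal O\cap B_s(x)$; it is a \emph{polynomial map} if there is $f\in K[X]$ with $T(x)=f(x)$ for all $x\in\mathcal O$. \textbf{Theorem.} (1) Let $r\in\mathcal V$, let $A$ be a stochastic matrix on $H=\mathcal O/B_r(0)$ (non-negative entries, each row with sum $1$), and let $\mathcal T_A$ be the set of all maps $T:\mathcal O\to\mathcal O$ that are locally scaling for $r$ and have associated transition matrix $A$. If $\mathcal T_A$ is non-empty, then (i) $\mathcal T_A$ contains a locally affine map; and (ii) $\mathcal T_A$ contains infinitely many polynomial maps. (2) There is a polynomial map $T:\mathcal O\to\mathcal O$, locally scaling for some $r\in\mathcal V$, which preserves the restriction of $\mu$ to $\mathcal O$ and is mixing: $\mu(T^{-n}(E)\cap F)\to\mu(E)\mu(F)$ as $n\to\infty$ for all measurable $E,F\subseteq\mathcal O$. -/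

import Mathlib

open MeasureTheory Filter Topology Polynomial

namespace NALocalField

noncomputable section

section Basic

variable (K : Type*) [NontriviallyNormedField K]

/-- The value set `𝒱 = |Kˣ|`, a set of positive real numbers. -/
abbrev ValueSet : Type := {r : ℝ // ∃ x : K, x ≠ 0 ∧ ‖x‖ = r}

variable {K} in
theorem ValueSet.pos (r : ValueSet K) : 0 < r.1 := by
  obtain ⟨x, hx, h⟩ := r.2
  rw [← h]
  exact norm_pos_iff.mpr hx

variable [IsUltrametricDist K]

/-- The ring `𝒪 = {x ∈ K : |x| ≤ 1}`. -/
abbrev Integers : Subring K := (NormedField.valuation (K := K)).integer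

variable {K}

theorem mem_integers {x : K} : x ∈ Integers K ↔ ‖x‖ ≤ 1 := Iff.rfl

theorem coe_integers : (Integers K : Set K) = Metric.closedBall 0 1 := by
  ext x
  rw [mem_closedBall_zero_iff]
  rfl

/-- The subgroup `B_r(0) ∩ 𝒪` of `𝒪` (it is `B_r(0)` as soon as `r ≤ 1`). -/
def ballSubgroup (r : ValueSet K) : AddSubgroup (Integers K) where
  carrier := {x | ‖(x : K)‖ ≤ r.1}
  zero_mem' := by simpa using r.pos.le
  add_mem' {x y} hx hy :=
    (IsUltrametricDist.norm_add_le_max (x : K) (y : K)).trans (max_le hx hy)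
  neg_mem' {x} hx := by
    have h : ‖(x : K)‖ ≤ r.1 := hx
    simpa using h

theorem mem_ballSubgroup {r : ValueSet K} {x : Integers K} :
    x ∈ ballSubgroup r ↔ ‖(x : K)‖ ≤ r.1 := Iff.rfl

/-- `H = 𝒪 / B_r(0)`, the set of cosets of `B_r(0)` in `𝒪`. -/
abbrev Cosets (r : ValueSet K) : Type _ := Integers K ⧸ ballSubgroup r

/-- The coset of `B_r(0)` that contains `x`. -/
abbrev toCoset (r : ValueSet K) (x : Integers K) : Cosets r := QuotientAddGroup.mk x

/-- `C` is a scaling function of `T` for the radius `r`. -/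
structure IsScalingFunction (r : ValueSet K) (T : Integers K → Integers K)
    (C : Integers K → ℝ) : Prop where
  one_le : ∀ x, 1 ≤ C x
  norm_sub : ∀ x y : Integers K, ‖(x : K) - y‖ ≤ r.1 →
    ‖(T x : K) - T y‖ = C x * ‖(x : K) - y‖

/-- `T : 𝒪 → 𝒪` is locally scaling for `r`: the set `𝒪` is a finite union of balls of radius
`r`, and `T` has a scaling function for `r`. -/
structure IsLocallyScaling (r : ValueSet K) (T : Integers K → Integers K) : Prop where
  finite_union : ∃ F : Finset K, (Integers K : Set K) = ⋃ a ∈ F, Metric.closedBall a r.1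
  exists_scaling : ∃ C : Integers K → ℝ, IsScalingFunction r T C

/-- A scaling function is constant on the cosets of `B_r(0)`. -/
theorem IsScalingFunction.eq_of_toCoset_eq {r : ValueSet K} {T : Integers K → Integers K}
    {C : Integers K → ℝ} (hC : IsScalingFunction r T C) (x y : Integers K)
    (h : toCoset r x = toCoset r y) : C x = C y := by
  have hm := QuotientAddGroup.eq.mp h
  rw [mem_ballSubgroup] at hm
  have hyx : ‖(y : K) - x‖ ≤ r.1 := by
    have e : ((-x + y : Integers K) : K) = (y : K) - x := by push_cast; ring
    rwa [e] at hm
  by_cases hxy : x = y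
  · rw [hxy]
  have hne : ‖(y : K) - x‖ ≠ 0 := by
    rw [norm_ne_zero_iff, sub_ne_zero]
    exact fun h' => hxy (Subtype.ext h'.symm)
  have h1 := hC.norm_sub y x hyx
  have h2 := hC.norm_sub x y (by rwa [norm_sub_rev])
  rw [norm_sub_rev (T x : K), norm_sub_rev (x : K), h1] at h2
  exact (mul_right_cancel₀ hne h2).symm

/-- The scaling function of a locally scaling map is unique: some `y ≠ x` has `|x - y| ≤ r`. -/
theorem IsScalingFunction.unique {r : ValueSet K} {T : Integers K → Integers K}
    {C C' : Integers K → ℝ} (hC : IsScalingFunction r T C) (hC' : IsScalingFunction r T C') :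
    C = C' := by
  funext x
  obtain ⟨z, hz, hzr⟩ := NormedField.exists_norm_lt K (lt_min r.pos one_pos)
  have hz1 : z ∈ Integers K := mem_integers.mpr (hzr.le.trans (min_le_right _ _))
  have e : (x : K) - (x + ⟨z, hz1⟩ : Integers K) = -z := by push_cast; ring
  have h : ‖(x : K) - (x + ⟨z, hz1⟩ : Integers K)‖ ≤ r.1 := by
    rw [e, norm_neg]
    exact hzr.le.trans (min_le_left _ _)
  have h1 := (hC.norm_sub x _ h).symm.trans (hC'.norm_sub x _ h)
  rw [e, norm_neg] at h1
  exact mul_right_cancel₀ hz.ne' h1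

/-- The scaling function `C : H → ℝ` of a locally scaling map, as a function of cosets. -/
def IsLocallyScaling.scaling {r : ValueSet K} {T : Integers K → Integers K}
    (hT : IsLocallyScaling r T) : Cosets r → ℝ :=
  fun i => Quotient.liftOn' i hT.exists_scaling.choose fun x y h =>
    hT.exists_scaling.choose_spec.eq_of_toCoset_eq x y (Quotient.sound' h)

/-- `T : 𝒪 → 𝒪` is locally affine. -/
def IsLocallyAffine (T : Integers K → Integers K) : Prop :=
  ∀ x : Integers K, ∃ s : ValueSet K, ∃ a b : K,
    ∀ y : Integers K, ‖(x : K) - y‖ ≤ s.1 → (T y : K) = a * y + b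

/-- `T : 𝒪 → 𝒪` is given by a polynomial with coefficients in `K`. -/
def IsPolynomialMap (T : Integers K → Integers K) : Prop :=
  ∃ f : K[X], ∀ x : Integers K, (T x : K) = f.eval (x : K)

end Basic

section Measure

variable (K : Type*) [NontriviallyNormedField K] [IsUltrametricDist K] [LocallyCompactSpace K]

/-- The ring `𝒪` as a compact set with nonempty interior. -/
def integersCompacts : TopologicalSpace.PositiveCompacts K where
  carrier := Integers K
  isCompact' := by
    have : ProperSpace K := ProperSpace.of_locallyCompactSpace K
    rw [coe_integers]
    exact isCompact_closedBall 0 1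
  interior_nonempty' := by
    rw [coe_integers]
    exact ⟨0, Metric.ball_subset_interior_closedBall (Metric.mem_ball_self one_pos)⟩

instance (r : ValueSet K) : Finite (Cosets r) := by
  have : CompactSpace (Integers K) := isCompact_iff_compactSpace.mp (integersCompacts K).isCompact'
  refine AddSubgroup.quotient_finite_of_isOpen (ballSubgroup r) ?_
  have e : (ballSubgroup r : Set (Integers K))
      = (fun x : Integers K => (x : K)) ⁻¹' Metric.closedBall 0 r.1 := by
    ext x
    rw [Set.mem_preimage, mem_closedBall_zero_iff]
    rfl
  rw [e]
  exact (IsUltrametricDist.isOpen_closedBall 0 r.pos.ne').preimage continuous_subtype_val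

instance (r : ValueSet K) : Fintype (Cosets r) := Fintype.ofFinite _

instance (r : ValueSet K) : DecidableEq (Cosets r) := Classical.decEq _

variable [MeasurableSpace K] [BorelSpace K]

/-- Haar measure on `K`, normalized to give `𝒪` measure `1`. -/
def haar : Measure K := Measure.addHaarMeasure (integersCompacts K)

/-- `ρ(r)`, the Haar measure of the ball `B_r(0)`. -/
def ballVolume (r : ℝ) : ℝ := (haar K).real (Metric.closedBall 0 r)

/-- The restriction of Haar measure to `𝒪`, as a measure on the type `𝒪`. -/
def haarIntegers : Measure (Integers K) := (haar K).comap Subtype.val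

variable {K}

open Classical in
/-- The associated transition matrix of a locally scaling map. -/
def IsLocallyScaling.transitionMatrix {r : ValueSet K} {T : Integers K → Integers K}
    (hT : IsLocallyScaling r T) : Matrix (Cosets r) (Cosets r) ℝ := fun i j =>
  if ∃ x : Integers K, toCoset r x = i ∧ toCoset r (T x) = j
  then ballVolume K (1 / hT.scaling i) else 0

/-- The set `𝒯_A` of all maps `𝒪 → 𝒪` that are locally scaling for `r` and have `A` as their
associated transition matrix. -/
def mapsWithMatrix {r : ValueSet K} (A : Matrix (Cosets r) (Cosets r) ℝ) :
    Set (Integers K → Integers K) :=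
  {T | ∃ hT : IsLocallyScaling r T, hT.transitionMatrix = A}

end Measure

/-- A transformation of a probability space is (strongly) mixing: `μ (T⁻ⁿ E ∩ F)` tends to
`μ E * μ F` for all measurable `E` and `F`. -/
def IsMixing {Ω : Type*} [MeasurableSpace Ω] (μ : Measure Ω) (T : Ω → Ω) : Prop :=
  ∀ E F : Set Ω, MeasurableSet E → MeasurableSet F →
    Tendsto (fun n : ℕ => μ (T^[n] ⁻¹' E ∩ F)) atTop (𝓝 (μ E * μ F))

end

end NALocalField

/-!
Write `π` for a uniformizer of `K` and `q` for the number of elements of the residue field. The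
whole proof rests on the congruence `|x ^ q - y ^ q| ≤ |π| |x - y|` for `x, y ∈ 𝒪` with
`|x - y| ≤ |π|` (`IsFrobeniusPair.norm_pow_sub_pow_le`).

*Maps with a given transition matrix.* A locally scaling map, divided on a ball of radius `r` by a
scalar of absolute value `C`, is an isometry of a compact ball into itself, hence onto. So the
image of the coset of `x` is the full ball of radius `C(x) r` around `T x`, and the transition
matrix depends only on `C` and these balls (`mem_mapsWithMatrix_of_norm_sub_le`). Hence `T` may be
replaced on each coset by an affine map with the same value at one point. Moreover `C ≥ 1`, so a
perturbation of size at most `r` whose Lipschitz constant is less than `1` changes nothing either,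
and it remains to approximate a map that is affine on cosets by polynomials, uniformly and in
Lipschitz constant at once. Limits of polynomials in this sense are closed under sums, products and
composition. The congruence shows that `1 - x ^ ((q - 1) * q ^ n)` converges in this sense to the
indicator of `π𝒪`; composition with `x ↦ x / π` on `π𝒪`, extended by `0`, gives the indicators of
all smaller balls, and so all functions that are affine on cosets
(`isLipLimit_of_affine_on_cosets`). Adding small constants to one approximating polynomial gives
infinitely many.

*A mixing polynomial.* Let `T x = (x ^ q - x) / π`. By the congruence, `T` multiplies distances up
to `|π|` by `1 / |π|`, so that `T^[k]` maps each ball of radius `|π| ^ k` bijectively onto `𝒪` and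
scales distances by `|π| ^ (-k)`. As the measure of a ball of radius `|π| ^ n` is the `n`-th power
of a constant, `(T^[k]) ⁻¹' E` is independent of every ball of radius `|π| ^ k`
(`haarIntegers_integersBall_inter_preimage`). Summation over the balls of radius `|π|` shows that
`T` preserves the measure, and mixing follows because balls form a generating π-system.
-/

namespace NALocalField

/-! ### The uniformizer and the Frobenius congruence -/

section Frobenius

variable {K : Type*} [NontriviallyNormedField K] [IsUltrametricDist K]

/-- `π` generates the maximal ideal of `𝒪`, and `q > 1` is an exponent for which `x ↦ x ^ q` is
the identity on the residue field, in which `q` vanishes. Over a local field `q` can be taken to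
be the number of elements of the residue field. -/
structure IsFrobeniusPair (π : K) (q : ℕ) : Prop where
  ne_zero : π ≠ 0
  norm_lt_one : ‖π‖ < 1
  norm_le : ∀ x : K, ‖x‖ < 1 → ‖x‖ ≤ ‖π‖
  one_lt : 1 < q
  norm_natCast_le : ‖(q : K)‖ ≤ ‖π‖
  norm_pow_sub_le : ∀ x : K, ‖x‖ ≤ 1 → ‖x ^ q - x‖ ≤ ‖π‖

theorem ultrametric_norm_add_le {x y : K} {M : ℝ} (hx : ‖x‖ ≤ M) (hy : ‖y‖ ≤ M) : ‖x + y‖ ≤ M :=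
  (IsUltrametricDist.norm_add_le_max x y).trans (max_le hx hy)

theorem ultrametric_norm_sub_le {x y : K} {M : ℝ} (hx : ‖x‖ ≤ M) (hy : ‖y‖ ≤ M) :
    ‖x - y‖ ≤ M := by
  rw [sub_eq_add_neg]
  exact ultrametric_norm_add_le hx (by rwa [norm_neg])

theorem norm_eq_of_norm_sub_lt {x y : K} (h : ‖x - y‖ < ‖y‖) : ‖x‖ = ‖y‖ := by
  have := IsUltrametricDist.norm_add_eq_max_of_norm_ne_norm (x := x - y) (y := y) h.ne
  rwa [sub_add_cancel, max_eq_right h.le] at this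

theorem norm_coe_integers_le (x : Integers K) : ‖(x : K)‖ ≤ 1 := x.2

/-- The maximal ideal of `𝒪`. -/
def maximalIdeal (K : Type*) [NontriviallyNormedField K] [IsUltrametricDist K] :
    Ideal (Integers K) where
  carrier := {x | ‖(x : K)‖ < 1}
  zero_mem' := by simp
  add_mem' {x y} hx hy :=
    (IsUltrametricDist.norm_add_le_max (x : K) (y : K)).trans_lt (max_lt hx hy)
  smul_mem' c x hx := by
    have hx' : ‖(x : K)‖ < 1 := hx
    have : ‖(c : K) * x‖ < 1 := by
      rw [norm_mul]
      exact mul_lt_one_of_nonneg_of_lt_one_right (norm_coe_integers_le c) (norm_nonneg _) hx'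
    exact this

theorem mem_maximalIdeal {x : Integers K} : x ∈ maximalIdeal K ↔ ‖(x : K)‖ < 1 := Iff.rfl

theorem maximalIdeal_isMaximal : (maximalIdeal K).IsMaximal := by
  rw [Ideal.isMaximal_iff]
  refine ⟨by simp [mem_maximalIdeal], fun J x _ hx hxJ => ?_⟩
  have hx1 : ‖(x : K)‖ = 1 := le_antisymm (norm_coe_integers_le x) (not_lt.mp hx)
  have hx0 : (x : K) ≠ 0 := norm_ne_zero_iff.mp (by rw [hx1]; exact one_ne_zero)
  have hi : (x : K)⁻¹ ∈ Integers K := by rw [mem_integers, norm_inv, hx1, inv_one]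
  have : (⟨(x : K)⁻¹, hi⟩ : Integers K) * x = 1 := Subtype.ext (inv_mul_cancel₀ hx0)
  rw [← this]
  exact J.mul_mem_left _ hxJ

variable [LocallyCompactSpace K]

instance : CompactSpace (Integers K) :=
  isCompact_iff_compactSpace.mp (integersCompacts K).isCompact'

theorem finite_residueField : Finite (Integers K ⧸ maximalIdeal K) := by
  refine AddSubgroup.quotient_finite_of_isOpen (maximalIdeal K).toAddSubgroup ?_
  exact isOpen_lt (continuous_subtype_val.norm) continuous_const

variable (K) in
/-- The open unit ball is closed, hence compact, and `π` is an element of maximal absolute value. -/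
theorem exists_isFrobeniusPair : ∃ (π : K) (q : ℕ), IsFrobeniusPair π q := by
  have : ProperSpace K := ProperSpace.of_locallyCompactSpace K
  have hc : IsCompact (Metric.ball (0 : K) 1) :=
    (isCompact_closedBall (0 : K) 1).of_isClosed_subset (IsUltrametricDist.isClosed_ball 0 1)
      Metric.ball_subset_closedBall
  obtain ⟨π, hπ, hmax⟩ := hc.exists_isMaxOn ⟨0, by simp⟩ (continuous_norm.continuousOn)
  rw [mem_ball_zero_iff] at hπ
  have hle : ∀ x : K, ‖x‖ < 1 → ‖x‖ ≤ ‖π‖ := fun x hx => hmax (mem_ball_zero_iff.mpr hx)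
  obtain ⟨z, hz, hz1⟩ := NormedField.exists_norm_lt_one K
  have hmaxl := maximalIdeal_isMaximal (K := K)
  let _ : Field (Integers K ⧸ maximalIdeal K) := Ideal.Quotient.field _
  have := finite_residueField (K := K)
  let _ : Fintype (Integers K ⧸ maximalIdeal K) := Fintype.ofFinite _
  refine ⟨π, Fintype.card (Integers K ⧸ maximalIdeal K),
    norm_pos_iff.mp (hz.trans_le (hle z hz1)), hπ, hle, Fintype.one_lt_card, hle _ ?_,
    fun x hx => hle _ ?_⟩
  · have h := FiniteField.cast_card_eq_zero (Integers K ⧸ maximalIdeal K)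
    rw [← map_natCast (Ideal.Quotient.mk (maximalIdeal K)), Ideal.Quotient.eq_zero_iff_mem,
      mem_maximalIdeal] at h
    simpa using h
  · have h := FiniteField.pow_card (Ideal.Quotient.mk (maximalIdeal K) ⟨x, hx⟩)
    rw [← map_pow, Ideal.Quotient.eq, mem_maximalIdeal] at h
    simpa using h

end Frobenius

namespace IsFrobeniusPair

variable {K : Type*} [NontriviallyNormedField K] {π : K} {q : ℕ}

theorem norm_pos (h : IsFrobeniusPair π q) : 0 < ‖π‖ := norm_pos_iff.mpr h.ne_zero

theorem norm_pow_pred_sub_one_le (h : IsFrobeniusPair π q) {x : K} (hx : ‖x‖ = 1) :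
    ‖x ^ (q - 1) - 1‖ ≤ ‖π‖ := by
  have h1 := h.norm_pow_sub_le x hx.le
  obtain ⟨m, rfl⟩ : ∃ m, q = m + 1 := ⟨q - 1, by have := h.one_lt; omega⟩
  have e : x ^ (m + 1) - x = x * (x ^ m - 1) := by ring
  rwa [e, norm_mul, hx, one_mul] at h1

theorem norm_eq_one_of_lt (h : IsFrobeniusPair π q) {x : K} (hx : ‖x‖ ≤ 1) (hπ : ‖π‖ < ‖x‖) :
    ‖x‖ = 1 :=
  hx.antisymm (not_lt.mp fun hlt => (h.norm_le x hlt).not_gt hπ)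

variable [IsUltrametricDist K]

/-- Modulo `(x - y) ^ 2`, the difference `x ^ q - y ^ q` is `q * y ^ (q - 1) * (x - y)`, and `q`
is divisible by `π`. -/
theorem norm_pow_sub_pow_le (h : IsFrobeniusPair π q) {x y : K} (hx : ‖x‖ ≤ 1) (hy : ‖y‖ ≤ 1)
    (hxy : ‖x - y‖ ≤ ‖π‖) : ‖x ^ q - y ^ q‖ ≤ ‖π‖ * ‖x - y‖ := by
  let y' : Integers K := ⟨y, hy⟩
  let x' : Integers K := ⟨x, hx⟩
  obtain ⟨k, hk⟩ := Polynomial.powAddExpansion y' (x' - y') q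
  have hk' : x ^ q = y ^ q + q * y ^ (q - 1) * (x - y) + k * (x - y) ^ 2 := by
    have := congrArg (Subtype.val : Integers K → K) hk
    simpa [x', y'] using this
  have e : x ^ q - y ^ q = (q * y ^ (q - 1) + k * (x - y)) * (x - y) := by rw [hk']; ring
  rw [e, norm_mul]
  refine mul_le_mul_of_nonneg_right (ultrametric_norm_add_le ?_ ?_) (norm_nonneg _)
  · rw [norm_mul, norm_pow]
    exact (mul_le_of_le_one_right (norm_nonneg _) (pow_le_one₀ (norm_nonneg _) hy)).trans
      h.norm_natCast_le
  · rw [norm_mul]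
    exact (mul_le_of_le_one_left (norm_nonneg _) (norm_coe_integers_le k)).trans hxy

theorem norm_pow_pow_sub_le (h : IsFrobeniusPair π q) {x y : K} (hx : ‖x‖ ≤ 1) (hy : ‖y‖ ≤ 1)
    (hxy : ‖x - y‖ ≤ ‖π‖) (n : ℕ) : ‖x ^ q ^ n - y ^ q ^ n‖ ≤ ‖π‖ ^ n * ‖x - y‖ := by
  induction n with
  | zero => simp
  | succ n ih =>
    rw [pow_succ q, pow_mul, pow_mul]
    have h1 : ‖π‖ ^ n * ‖x - y‖ ≤ ‖π‖ :=
      (mul_le_of_le_one_left (norm_nonneg _)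
        (pow_le_one₀ (norm_nonneg _) h.norm_lt_one.le)).trans hxy
    have hb : ∀ {z : K}, ‖z‖ ≤ 1 → ‖z ^ q ^ n‖ ≤ 1 := fun hz => by
      rw [norm_pow]; exact pow_le_one₀ (norm_nonneg _) hz
    calc _ ≤ ‖π‖ * ‖x ^ q ^ n - y ^ q ^ n‖ :=
          h.norm_pow_sub_pow_le (hb hx) (hb hy) (ih.trans h1)
      _ ≤ ‖π‖ * (‖π‖ ^ n * ‖x - y‖) := mul_le_mul_of_nonneg_left ih (norm_nonneg _)
      _ = _ := by ring

end IsFrobeniusPair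

/-! ### Polynomial approximation in the Lipschitz norm -/

section Approximation

variable {K : Type*} [NontriviallyNormedField K] [IsUltrametricDist K]

/-- The function `g : 𝒪 → K` is bounded by `M` and is `M`-Lipschitz: its Lipschitz norm is at
most `M`. -/
structure LipBound (M : ℝ) (g : Integers K → K) : Prop where
  norm_le : ∀ x, ‖g x‖ ≤ M
  norm_sub_le : ∀ x y : Integers K, ‖g x - g y‖ ≤ M * ‖(x : K) - y‖

namespace LipBound

variable {M N : ℝ} {f g : Integers K → K}

theorem nonneg (hg : LipBound M g) : 0 ≤ M := (norm_nonneg _).trans (hg.norm_le 0)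

theorem mono (hg : LipBound M g) (h : M ≤ N) : LipBound N g :=
  ⟨fun x => (hg.norm_le x).trans h,
    fun x y => (hg.norm_sub_le x y).trans (mul_le_mul_of_nonneg_right h (norm_nonneg _))⟩

theorem add (hf : LipBound M f) (hg : LipBound M g) : LipBound M fun x => f x + g x := by
  refine ⟨fun x => ultrametric_norm_add_le (hf.norm_le x) (hg.norm_le x), fun x y => ?_⟩
  rw [add_sub_add_comm]
  exact ultrametric_norm_add_le (hf.norm_sub_le x y) (hg.norm_sub_le x y)

theorem mul (hf : LipBound M f) (hg : LipBound N g) : LipBound (M * N) fun x => f x * g x := by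
  refine ⟨fun x => ?_, fun x y => ?_⟩
  · rw [norm_mul]
    exact mul_le_mul (hf.norm_le x) (hg.norm_le x) (norm_nonneg _) hf.nonneg
  · have e : f x * g x - f y * g y = f x * (g x - g y) + (f x - f y) * g y := by ring
    rw [e]
    refine ultrametric_norm_add_le ?_ ?_
    · rw [norm_mul, mul_assoc]
      exact mul_le_mul (hf.norm_le x) (hg.norm_sub_le x y) (norm_nonneg _) hf.nonneg
    · rw [norm_mul, mul_right_comm]
      exact mul_le_mul (hf.norm_sub_le x y) (hg.norm_le y) (norm_nonneg _)
        (mul_nonneg hf.nonneg (norm_nonneg _))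

theorem const (c : K) : LipBound ‖c‖ fun _ : Integers K => c :=
  ⟨fun _ => le_rfl, fun x y => by simpa using mul_nonneg (norm_nonneg _) (norm_nonneg _)⟩

theorem coe : LipBound 1 fun x : Integers K => (x : K) :=
  ⟨norm_coe_integers_le, fun x y => by simp⟩

theorem comp {u : Integers K → Integers K} (hf : LipBound M f)
    (hu : LipBound N fun x => (u x : K)) : LipBound (M * max N 1) fun x => f (u x) := by
  refine ⟨fun x => (hf.norm_le _).trans (le_mul_of_one_le_right hf.nonneg (le_max_right _ _)),
    fun x y => (hf.norm_sub_le _ _).trans ?_⟩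
  rw [mul_assoc]
  refine mul_le_mul_of_nonneg_left ((hu.norm_sub_le x y).trans ?_) hf.nonneg
  exact mul_le_mul_of_nonneg_right (le_max_left _ _) (norm_nonneg _)

theorem exists_eval (p : K[X]) : ∃ M, LipBound M fun x : Integers K => p.eval (x : K) := by
  induction p using Polynomial.induction_on' with
  | add p₁ p₂ h₁ h₂ =>
    obtain ⟨M₁, h₁⟩ := h₁
    obtain ⟨M₂, h₂⟩ := h₂
    simp only [eval_add]
    exact ⟨_, (h₁.mono (le_max_left M₁ M₂)).add (h₂.mono (le_max_right M₁ M₂))⟩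
  | monomial n c =>
    induction n with
    | zero => exact ⟨_, by simpa using const c⟩
    | succ n ih =>
      obtain ⟨M, hM⟩ := ih
      refine ⟨M * 1, ?_⟩
      simpa only [eval_monomial, pow_succ, mul_assoc] using hM.mul coe

end LipBound

/-- The function `g` is a limit of polynomial functions on `𝒪` in the Lipschitz norm. -/
def IsLipLimit (g : Integers K → K) : Prop :=
  ∀ ε > 0, ∃ p : K[X], LipBound ε fun x : Integers K => p.eval (x : K) - g x

namespace IsLipLimit

variable {f g : Integers K → K}

theorem of_eval (p : K[X]) : IsLipLimit fun x : Integers K => p.eval (x : K) := fun ε hε =>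
  ⟨p, by simpa using (LipBound.const (0 : K)).mono (by simpa using hε.le)⟩

theorem const (c : K) : IsLipLimit fun _ : Integers K => c := by
  simpa using of_eval (C c)

theorem coe : IsLipLimit fun x : Integers K => (x : K) := by
  simpa using of_eval (X : K[X])

theorem exists_lipBound (hg : IsLipLimit g) : ∃ M, 0 < M ∧ LipBound M g := by
  obtain ⟨p, hp⟩ := hg 1 one_pos
  obtain ⟨M, hM⟩ := LipBound.exists_eval p
  refine ⟨max M 1, lt_max_of_lt_right one_pos, ?_⟩
  have h := (hM.mono (le_max_left M 1)).add
    (((LipBound.const (-1 : K)).mul hp).mono (N := max M 1) (by simp))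
  simpa using h

theorem add (hf : IsLipLimit f) (hg : IsLipLimit g) : IsLipLimit fun x => f x + g x := by
  intro ε hε
  obtain ⟨p, hp⟩ := hf ε hε
  obtain ⟨p', hp'⟩ := hg ε hε
  refine ⟨p + p', ?_⟩
  simpa [add_sub_add_comm] using hp.add hp'

theorem sum {ι : Type*} (s : Finset ι) {F : ι → Integers K → K} (h : ∀ i, IsLipLimit (F i)) :
    IsLipLimit fun x => ∑ i ∈ s, F i x := by
  classical
  induction s using Finset.induction_on with
  | empty => simpa using const (0 : K)
  | insert a s ha ih => simpa [Finset.sum_insert ha] using (h a).add ih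

theorem mul (hf : IsLipLimit f) (hg : IsLipLimit g) : IsLipLimit fun x => f x * g x := by
  intro ε hε
  obtain ⟨M, hM0, hM⟩ := hg.exists_lipBound
  obtain ⟨p, hp⟩ := hf (ε / M) (div_pos hε hM0)
  obtain ⟨N, hN⟩ := LipBound.exists_eval p
  have hN0 : 0 < max N 1 := lt_max_of_lt_right one_pos
  obtain ⟨p', hp'⟩ := hg (ε / max N 1) (div_pos hε hN0)
  refine ⟨p * p', ?_⟩
  have h := (((hN.mono (le_max_left N 1)).mul hp').mono (mul_div_cancel₀ ε hN0.ne').le).add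
    ((hp.mul hM).mono (div_mul_cancel₀ ε hM0.ne').le)
  convert h using 2 with x
  rw [eval_mul]
  ring

theorem of_approx (h : ∀ ε > 0, ∃ f, IsLipLimit f ∧ LipBound ε fun x => f x - g x) :
    IsLipLimit g := by
  intro ε hε
  obtain ⟨f, hf, hfg⟩ := h ε hε
  obtain ⟨p, hp⟩ := hf ε hε
  exact ⟨p, by simpa using hp.add hfg⟩

theorem eval_comp (p : K[X]) (hg : IsLipLimit g) : IsLipLimit fun x => p.eval (g x) := by
  induction p using Polynomial.induction_on' with
  | add p₁ p₂ h₁ h₂ => simpa using h₁.add h₂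
  | monomial n c =>
    induction n with
    | zero => simpa using const c
    | succ n ih => simpa [pow_succ, mul_assoc] using ih.mul hg

theorem comp {u : Integers K → Integers K} (hf : IsLipLimit f)
    (hu : IsLipLimit fun x => (u x : K)) : IsLipLimit fun x => f (u x) := by
  refine of_approx fun ε hε => ?_
  obtain ⟨M, hM0, hM⟩ := hu.exists_lipBound
  have h1 : 0 < max M 1 := lt_max_of_lt_right one_pos
  obtain ⟨p, hp⟩ := hf (ε / max M 1) (div_pos hε h1)
  exact ⟨_, eval_comp p hu, (hp.comp hM).mono (div_mul_cancel₀ ε h1.ne').le⟩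

end IsLipLimit

open Classical in
/-- The indicator function of the ball `B_s(0)`, as a function `𝒪 → K`. -/
noncomputable def ballIndicator (s : ℝ) (x : Integers K) : K := if ‖(x : K)‖ ≤ s then 1 else 0

variable {π : K} {q : ℕ}

/-- The indicator function of the maximal ideal is the limit of `1 - x ^ ((q - 1) * q ^ n)`. -/
theorem IsFrobeniusPair.isLipLimit_ballIndicator (h : IsFrobeniusPair π q) :
    IsLipLimit (ballIndicator (K := K) ‖π‖) := by
  intro ε hε
  obtain ⟨n, hn⟩ := exists_pow_lt_of_lt_one hε h.norm_lt_one
  -- `x ^ (q - 1)` is congruent to `0` or to `1` modulo `π`, and the `q ^ n`-th power contracts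
  -- congruence classes by the factor `|π| ^ n`.
  have hpow : ∀ x : Integers K, ‖(x : K) ^ (q - 1)‖ ≤ 1 := fun x => by
    rw [norm_pow]; exact pow_le_one₀ (norm_nonneg _) (norm_coe_integers_le x)
  have hq : q ^ n ≠ 0 := pow_ne_zero _ (by have := h.one_lt; omega)
  have hsup : ∀ x : Integers K,
      ‖1 - ((x : K) ^ (q - 1)) ^ q ^ n - ballIndicator ‖π‖ x‖ ≤ ‖π‖ ^ n := by
    intro x
    unfold ballIndicator
    split_ifs with hx
    · have hx' : ‖(x : K) ^ (q - 1) - 0‖ ≤ ‖π‖ := by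
        rw [sub_zero, norm_pow]
        exact (pow_le_of_le_one (norm_nonneg _) (norm_coe_integers_le x)
          (by have := h.one_lt; omega)).trans hx
      have := h.norm_pow_pow_sub_le (hpow x) (by simp) hx' n
      rw [zero_pow hq, sub_zero] at this
      rw [sub_sub_cancel_left, norm_neg]
      exact this.trans (mul_le_of_le_one_right (by positivity) (hx'.trans h.norm_lt_one.le))
    · have hx1 := h.norm_eq_one_of_lt (norm_coe_integers_le x) (not_le.mp hx)
      have hx' := h.norm_pow_pred_sub_one_le hx1
      have := h.norm_pow_pow_sub_le (hpow x) (by simp) hx' n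
      rw [one_pow] at this
      rw [sub_zero, norm_sub_rev]
      exact this.trans (mul_le_of_le_one_right (by positivity) (hx'.trans h.norm_lt_one.le))
  refine ⟨1 - (X ^ (q - 1)) ^ q ^ n, fun x => ?_, fun x y => ?_⟩
  · simpa using (hsup x).trans hn.le
  simp only [eval_sub, eval_one, eval_pow, eval_X]
  refine le_trans ?_ (mul_le_mul_of_nonneg_right hn.le (norm_nonneg _))
  by_cases hxy : ‖(x : K) - y‖ ≤ ‖π‖
  · have hind : ballIndicator ‖π‖ x = ballIndicator ‖π‖ y := by
      unfold ballIndicator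
      congr 1
      refine propext ⟨fun hx => ?_, fun hy => ?_⟩
      · simpa using ultrametric_norm_sub_le hx hxy
      · simpa using ultrametric_norm_add_le hxy hy
    have hsub : ‖(x : K) ^ (q - 1) - (y : K) ^ (q - 1)‖ ≤ ‖(x : K) - y‖ := by
      obtain ⟨k, hk⟩ := sub_dvd_pow_sub_pow x y (q - 1)
      have hk' : (x : K) ^ (q - 1) - (y : K) ^ (q - 1) = (x - y) * k := by
        simpa using congrArg (Subtype.val : Integers K → K) hk
      rw [hk', norm_mul]
      exact mul_le_of_le_one_right (norm_nonneg _) (norm_coe_integers_le k)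
    have e : 1 - ((x : K) ^ (q - 1)) ^ q ^ n - ballIndicator ‖π‖ x
        - (1 - ((y : K) ^ (q - 1)) ^ q ^ n - ballIndicator ‖π‖ y)
        = -(((x : K) ^ (q - 1)) ^ q ^ n - ((y : K) ^ (q - 1)) ^ q ^ n) := by
      rw [hind]; ring
    rw [e, norm_neg]
    exact (h.norm_pow_pow_sub_le (hpow x) (hpow y) (hsub.trans hxy) n).trans
      (mul_le_mul_of_nonneg_left hsub (by positivity))
  -- At distance `1` the Lipschitz bound is the uniform bound.
  · have h1 : ‖(x : K) - y‖ = 1 :=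
      h.norm_eq_one_of_lt (norm_coe_integers_le (x - y)) (not_le.mp hxy)
    rw [h1, mul_one]
    exact ultrametric_norm_sub_le (hsup x) (hsup y)

/-- On `𝒪`, the indicator of `B_{|π|^(n+1)}(0)` is `χ(x) * χₙ(χ(x) * x / π)`, where `χ` and `χₙ`
are the indicators of `B_{|π|}(0)` and `B_{|π|^n}(0)`; the inner map sends `𝒪` to `𝒪`. -/
theorem IsFrobeniusPair.isLipLimit_ballIndicator_pow (h : IsFrobeniusPair π q) (n : ℕ) :
    IsLipLimit (ballIndicator (K := K) (‖π‖ ^ n)) := by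
  induction n with
  | zero =>
    have : ballIndicator (K := K) (‖π‖ ^ 0) = fun _ => 1 := by
      funext x
      simp [ballIndicator, norm_coe_integers_le x]
    rw [this]
    exact .const 1
  | succ n ih =>
    have hmem : ∀ x : Integers K, ballIndicator ‖π‖ x * (x * π⁻¹) ∈ Integers K := fun x => by
      unfold ballIndicator
      split_ifs with hx
      · rw [one_mul, mem_integers, norm_mul, norm_inv]
        exact mul_inv_le_one_of_le₀ hx (norm_nonneg _)
      · simp
    let u : Integers K → Integers K := fun x => ⟨_, hmem x⟩
    have hu : IsLipLimit fun x => (u x : K) :=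
      h.isLipLimit_ballIndicator.mul (IsLipLimit.coe.mul (.const _))
    have e : ballIndicator (K := K) (‖π‖ ^ (n + 1))
        = fun x => ballIndicator ‖π‖ x * ballIndicator (‖π‖ ^ n) (u x) := by
      funext x
      by_cases hx : ‖(x : K)‖ ≤ ‖π‖
      · have hux : ‖(u x : K)‖ ≤ ‖π‖ ^ n ↔ ‖(x : K)‖ ≤ ‖π‖ ^ (n + 1) := by
          simp only [u, ballIndicator, if_pos hx, one_mul, norm_mul, norm_inv]
          rw [← div_eq_mul_inv, div_le_iff₀ h.norm_pos, pow_succ]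
        simp only [ballIndicator, if_pos hx, hux, one_mul]
      · have hx' : ¬ ‖(x : K)‖ ≤ ‖π‖ ^ (n + 1) := fun h' => hx <| h'.trans <|
          pow_le_of_le_one (norm_nonneg _) h.norm_lt_one.le n.succ_ne_zero
        simp only [ballIndicator, if_neg hx, if_neg hx', zero_mul]
    rw [e]
    exact h.isLipLimit_ballIndicator.mul (ih.comp hu)

/-- A function that is affine on every coset of a ball around `0` is a limit of polynomials in the
Lipschitz norm. The radius need not be a power of `|π|`, so a smaller power is used. -/
theorem isLipLimit_of_affine_on_cosets [LocallyCompactSpace K] (r : ValueSet K)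
    {g : Integers K → K}
    (hg : ∀ x : Integers K, ∃ a b : K, ∀ y : Integers K, ‖(x : K) - y‖ ≤ r.1 → g y = a * y + b) :
    IsLipLimit g := by
  obtain ⟨π, q, h⟩ := exists_isFrobeniusPair K
  obtain ⟨n, hn⟩ := exists_pow_lt_of_lt_one r.pos h.norm_lt_one
  let s : ValueSet K := ⟨‖π‖ ^ n, π ^ n, pow_ne_zero _ h.ne_zero, norm_pow _ _⟩
  choose a b hab using hg
  let x₀ : Cosets s → Integers K := Quotient.out
  have e : g = fun y : Integers K => ∑ i : Cosets s,
      ballIndicator (‖π‖ ^ n) (y - x₀ i) * (a (x₀ i) * y + b (x₀ i)) := by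
    funext y
    have hi : ∀ i : Cosets s, toCoset s y = i ↔ ‖((y - x₀ i : Integers K) : K)‖ ≤ ‖π‖ ^ n := by
      intro i
      have h1 : toCoset s (x₀ i) = i := Quotient.out_eq i
      have h2 : -(x₀ i) + y = y - x₀ i := by ring
      rw [← h1, eq_comm, QuotientAddGroup.eq, h1, mem_ballSubgroup, h2]
    rw [Finset.sum_eq_single (toCoset s y)]
    · have hle := (hi (toCoset s y)).mp rfl
      rw [ballIndicator, if_pos hle, one_mul]
      refine hab _ y ?_
      rw [norm_sub_rev]
      exact hle.trans hn.le
    · intro i _ hne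
      rw [ballIndicator, if_neg fun hle => hne ((hi i).mpr hle).symm, zero_mul]
    · simp
  rw [e]
  refine .sum _ fun i => .mul ((h.isLipLimit_ballIndicator_pow n).comp
    (u := fun y : Integers K => y - x₀ i) ?_) (((IsLipLimit.const _).mul .coe).add (.const _))
  simpa [sub_eq_add_neg] using IsLipLimit.coe.add (.const (-(x₀ i : K)))

end Approximation

/-! ### Images of balls under locally scaling maps -/

/-- If `z` had distance at least `ε` from the range, its orbit would be `ε`-separated. -/
theorem surjective_of_isometry_of_compactSpace {X : Type*} [MetricSpace X] [CompactSpace X]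
    {f : X → X} (hf : Isometry f) : Function.Surjective f := by
  intro z
  by_contra hz
  have hcl : IsClosed (Set.range f) := (isCompact_range hf.continuous).isClosed
  obtain ⟨ε, hε, hball⟩ := Metric.isOpen_iff.mp hcl.isOpen_compl z hz
  have hfar : ∀ y, ε ≤ dist (f y) z := fun y => by
    by_contra! hy
    exact hball (Metric.mem_ball.mpr hy) ⟨y, rfl⟩
  obtain ⟨_, -, φ, hφ, hlim⟩ :=
    isCompact_univ.tendsto_subseq (x := fun n => f^[n] z) fun _ => Set.mem_univ _
  obtain ⟨N, hN⟩ := Metric.cauchySeq_iff.mp hlim.cauchySeq ε hε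
  have hlt := hN (N + 1) N.le_succ N le_rfl
  obtain ⟨k, hk⟩ := Nat.exists_eq_add_of_lt (hφ N.lt_succ_self)
  have hiso : ∀ m, Isometry f^[m] := fun m => by
    induction m with
    | zero => exact isometry_id
    | succ m ih => rw [Function.iterate_succ]; exact ih.comp hf
  rw [Function.comp_apply, Function.comp_apply, hk, add_assoc, Function.iterate_add_apply,
    (hiso _).dist_eq, Function.iterate_succ_apply'] at hlt
  exact hlt.not_ge (hfar _)

section LocallyScaling

variable {K : Type*} [NontriviallyNormedField K] [IsUltrametricDist K] {r : ValueSet K}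
  {T T' : Integers K → Integers K} {C : Integers K → ℝ}

theorem dist_integers (x y : Integers K) : dist x y = ‖(x : K) - y‖ := by
  rw [Subtype.dist_eq, dist_eq_norm]

theorem toCoset_eq_iff {x y : Integers K} :
    toCoset r x = toCoset r y ↔ ‖(x : K) - y‖ ≤ r.1 := by
  have e : ((-x + y : Integers K) : K) = -(x - y) := by push_cast; ring
  rw [QuotientAddGroup.eq, mem_ballSubgroup, e, norm_neg]

theorem exists_norm_le_valueSet (r : ValueSet K) : ∃ z : Integers K, z ≠ 0 ∧ ‖(z : K)‖ ≤ r.1 := by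
  obtain ⟨z, hz, hzr⟩ := NormedField.exists_norm_lt K (lt_min r.pos one_pos)
  refine ⟨⟨z, hzr.le.trans (min_le_right _ _)⟩, fun h => hz.ne' ?_, hzr.le.trans (min_le_left _ _)⟩
  rw [norm_eq_zero]
  exact congrArg Subtype.val h

theorem IsScalingFunction.exists_norm_eq (hC : IsScalingFunction r T C) (x : Integers K) :
    ∃ a : K, ‖a‖ = C x := by
  obtain ⟨z, hz0, hz⟩ := exists_norm_le_valueSet r
  have hz0' : ‖(z : K)‖ ≠ 0 := norm_ne_zero_iff.mpr fun h => hz0 (Subtype.ext h)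
  have e : (x : K) - (x + z : Integers K) = -z := by push_cast; ring
  have h := hC.norm_sub x (x + z) (by rwa [e, norm_neg])
  refine ⟨((T x : K) - T (x + z)) / z, ?_⟩
  rw [norm_div, h, e, norm_neg, mul_div_cancel_right₀ _ hz0']

/-- The covering condition excludes radii `r > 1`: a ball of such a radius is not contained
in `𝒪`. -/
theorem IsLocallyScaling.radius_le_one (hT : IsLocallyScaling r T) : r.1 ≤ 1 := by
  obtain ⟨F, hF⟩ := hT.finite_union
  have h0 : (0 : K) ∈ (Integers K : Set K) := (Integers K).zero_mem
  rw [hF, Set.mem_iUnion₂] at h0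
  obtain ⟨a, ha, h0a⟩ := h0
  obtain ⟨z, -, hz⟩ := r.2
  have hzO : z ∈ (Integers K : Set K) := by
    rw [hF, Set.mem_iUnion₂]
    refine ⟨a, ha, ?_⟩
    rw [IsUltrametricDist.closedBall_eq_of_mem h0a, mem_closedBall_zero_iff, hz]
  rw [← hz]
  exact hzO

theorem IsLocallyScaling.scaling_toCoset (hT : IsLocallyScaling r T)
    (hC : IsScalingFunction r T C) (x : Integers K) : hT.scaling (toCoset r x) = C x :=
  congrFun (hT.exists_scaling.choose_spec.unique hC) x

/-- A perturbation that is less than `1`-Lipschitz does not change the scaling function, as its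
values are at least `1`. -/
theorem IsScalingFunction.perturb (hC : IsScalingFunction r T C) {ε : ℝ} (hε : ε < 1)
    
    (h : ∀ x y, ‖(T' x : K) - T x - (T' y - T y)‖ ≤ ε * ‖(x : K) - y‖) :
    IsScalingFunction r T' C := by
  refine ⟨hC.one_le, fun x y hxy => ?_⟩
  rw [← hC.norm_sub x y hxy]
  by_cases hne : x = y
  · simp [hne]
  have hpos : 0 < ‖(x : K) - y‖ :=
    norm_pos_iff.mpr (sub_ne_zero.mpr fun h' => hne (Subtype.ext h'))
  refine norm_eq_of_norm_sub_lt ?_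
  have e : (T' x : K) - T' y - (T x - T y) = T' x - T x - (T' y - T y) := by ring
  rw [e, hC.norm_sub x y hxy]
  refine (h x y).trans_lt (mul_lt_mul_of_pos_right ?_ hpos)
  exact hε.trans_le (hC.one_le x)

variable [LocallyCompactSpace K]

/-- The image of a ball of radius `r` is a full ball: dividing by a scalar of absolute value `C x`
gives an isometry of the compact ball into itself. -/
theorem IsScalingFunction.exists_eq_of_norm_sub_le (hC : IsScalingFunction r T C) (hr : r.1 ≤ 1)
    (x w : Integers K) (hw : ‖(w : K) - T x‖ ≤ C x * r.1) :
    ∃ y : Integers K, ‖(x : K) - y‖ ≤ r.1 ∧ T y = w := by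
  obtain ⟨a, ha⟩ := hC.exists_norm_eq x
  have hCpos : 0 < C x := one_pos.trans_le (hC.one_le x)
  have ha0 : a ≠ 0 := norm_pos_iff.mp (ha ▸ hCpos)
  let B : Set (Integers K) := {y | ‖(x : K) - y‖ ≤ r.1}
  have hB : B = Metric.closedBall x r.1 := by
    ext y
    rw [Metric.mem_closedBall, dist_comm, dist_integers]
    rfl
  have : CompactSpace B :=
    isCompact_iff_compactSpace.mp (hB ▸ Metric.isClosed_closedBall).isCompact
  have hmem : ∀ v : K, ‖v - T x‖ ≤ C x * r.1 → ‖a⁻¹ * (v - T x)‖ ≤ r.1 := fun v hv => by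
    rw [norm_mul, norm_inv, ha, inv_mul_le_iff₀ hCpos]
    exact hv
  let ψ : ∀ v : K, ‖v - T x‖ ≤ C x * r.1 → B := fun v hv =>
    ⟨⟨x + a⁻¹ * (v - T x),
      ultrametric_norm_add_le (norm_coe_integers_le x) ((hmem v hv).trans hr)⟩, by
      change ‖(x : K) - (x + a⁻¹ * (v - T x))‖ ≤ r.1
      rw [sub_add_cancel_left, norm_neg]
      exact hmem v hv⟩
  have hTB : ∀ y : B, ‖(T y : K) - T x‖ ≤ C x * r.1 := fun y => by
    rw [norm_sub_rev, hC.norm_sub x y y.2]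
    exact mul_le_mul_of_nonneg_left y.2 hCpos.le
  have hiso : Isometry fun y : B => ψ (T y) (hTB y) := by
    refine Isometry.of_dist_eq fun y z => ?_
    have hyz : ‖((y : Integers K) : K) - (z : Integers K)‖ ≤ r.1 := by
      have := ultrametric_norm_sub_le z.2 y.2
      rwa [sub_sub_sub_cancel_left] at this
    have hCy : C y = C x := hC.eq_of_toCoset_eq _ _ <| by
      rw [toCoset_eq_iff, norm_sub_rev]; exact y.2
    rw [Subtype.dist_eq, Subtype.dist_eq y z, dist_integers, dist_integers]
    change ‖(x : K) + a⁻¹ * (T y - T x) - (x + a⁻¹ * (T z - T x))‖ = _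
    rw [add_sub_add_left_eq_sub, ← mul_sub, sub_sub_sub_cancel_right, norm_mul, norm_inv, ha,
      hC.norm_sub _ _ hyz, hCy, inv_mul_cancel_left₀ hCpos.ne']
  obtain ⟨y, hy⟩ := surjective_of_isometry_of_compactSpace hiso (ψ w hw)
  refine ⟨y, y.2, Subtype.ext ?_⟩
  have hy' : (x : K) + a⁻¹ * (T y - T x) = x + a⁻¹ * (w - T x) :=
    congrArg (fun b : B => ((b : Integers K) : K)) hy
  simpa [ha0] using hy'

theorem isLocallyScaling_of_isScalingFunction (hr : r.1 ≤ 1) (hC : IsScalingFunction r T C) :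
    IsLocallyScaling r T := by
  refine ⟨?_, C, hC⟩
  classical
  let x₀ : Cosets r → Integers K := Quotient.out
  refine ⟨Finset.univ.image fun i => (x₀ i : K), Set.Subset.antisymm (fun y hy => ?_) ?_⟩
  · rw [Set.mem_iUnion₂]
    refine ⟨x₀ (toCoset r ⟨y, hy⟩), Finset.mem_image_of_mem _ (Finset.mem_univ _), ?_⟩
    rw [mem_closedBall_iff_norm]
    exact toCoset_eq_iff.mp (Quotient.out_eq (toCoset r ⟨y, hy⟩)).symm
  · refine Set.iUnion₂_subset fun a ha y hy => ?_
    obtain ⟨i, -, rfl⟩ := Finset.mem_image.mp ha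
    rw [mem_closedBall_iff_norm] at hy
    have : ‖y - x₀ i + x₀ i‖ ≤ 1 := ultrametric_norm_add_le (hy.trans hr) (norm_coe_integers_le _)
    rwa [sub_add_cancel] at this

variable [MeasurableSpace K] [BorelSpace K]

/-- The transition matrix depends only on the scaling function `C` and on the balls
`B_{C(x)r}(T x)`, which are the images of the cosets. -/
theorem mem_mapsWithMatrix_of_norm_sub_le {A : Matrix (Cosets r) (Cosets r) ℝ}
    (hT : IsLocallyScaling r T) (hA : hT.transitionMatrix = A) (hC : IsScalingFunction r T C)
    (hC' : IsScalingFunction r T' C) (h : ∀ x, ‖(T x : K) - T' x‖ ≤ C x * r.1) :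
    T' ∈ mapsWithMatrix A := by
  have hr := hT.radius_le_one
  have hT' := isLocallyScaling_of_isScalingFunction hr hC'
  refine ⟨hT', ?_⟩
  -- Given `x` in the coset `i` with `T x` in `j`, surjectivity yields such a point for `T'`.
  have key : ∀ {S S' : Integers K → Integers K}, IsScalingFunction r S' C →
      (∀ x, ‖(S x : K) - S' x‖ ≤ C x * r.1) → ∀ i j : Cosets r,
      (∃ x : Integers K, toCoset r x = i ∧ toCoset r (S x) = j) →
      ∃ x : Integers K, toCoset r x = i ∧ toCoset r (S' x) = j := by
    rintro S S' hS' hSS i j ⟨x, hx, hj⟩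
    obtain ⟨y, hy, hyx⟩ := hS'.exists_eq_of_norm_sub_le hr x (S x) (hSS x)
    exact ⟨y, by rw [← hx, eq_comm, toCoset_eq_iff]; exact hy, by rw [hyx, hj]⟩
  rw [← hA]
  ext i j
  have hs : hT'.scaling i = hT.scaling i := by
    obtain ⟨x, rfl⟩ := QuotientAddGroup.mk_surjective i
    exact (hT'.scaling_toCoset hC' x).trans (hT.scaling_toCoset hC x).symm
  unfold IsLocallyScaling.transitionMatrix
  rw [hs]
  congr 1
  exact propext ⟨key hC (fun x => by rw [norm_sub_rev]; exact h x) i j, key hC' h i j⟩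

/-! ### Locally affine and polynomial maps with a given transition matrix -/

/-- On each coset, `T` is replaced by an affine map with the same value at a representative. -/
theorem exists_locallyAffine_mem_mapsWithMatrix {A : Matrix (Cosets r) (Cosets r) ℝ}
    (hT : IsLocallyScaling r T) (hA : hT.transitionMatrix = A) (hC : IsScalingFunction r T C) :
    ∃ T' ∈ mapsWithMatrix A, IsScalingFunction r T' C ∧ ∀ x : Integers K, ∃ a b : K,
      ∀ y : Integers K, ‖(x : K) - y‖ ≤ r.1 → (T' y : K) = a * y + b := by
  choose a ha using hC.exists_norm_eq
  let ρ : Integers K → Integers K := fun x => Quotient.out (toCoset r x)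
  have hρ : ∀ x : Integers K, ‖(x : K) - ρ x‖ ≤ r.1 := fun x =>
    toCoset_eq_iff.mp (Quotient.out_eq (toCoset r x)).symm
  have hCρ : ∀ x, C (ρ x) = C x := fun x =>
    hC.eq_of_toCoset_eq _ _ (Quotient.out_eq (toCoset r x))
  have hpos : ∀ x, 0 < C x := fun x => one_pos.trans_le (hC.one_le x)
  have hρeq : ∀ x y : Integers K, ‖(x : K) - y‖ ≤ r.1 → ρ x = ρ y := fun x y hxy =>
    congrArg Quotient.out (toCoset_eq_iff.mpr hxy)
  -- `C x * r ≤ 1`, since some point of the coset of `x` is mapped to distance `C x * r`.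
  have hCr : ∀ x, C x * r.1 ≤ 1 := fun x => by
    obtain ⟨z, -, hz⟩ := r.2
    have hz1 : ‖z‖ ≤ 1 := hz.trans_le hT.radius_le_one
    have e : (x : K) - (x + ⟨z, hz1⟩ : Integers K) = -z := by push_cast; ring
    have h := hC.norm_sub x (x + ⟨z, hz1⟩) (by rw [e, norm_neg, hz])
    rw [e, norm_neg, hz] at h
    rw [← h]
    exact norm_coe_integers_le (T x - T (x + ⟨z, hz1⟩))
  have hsmall : ∀ x : Integers K, ‖a (ρ x) * ((x : K) - ρ x)‖ ≤ C x * r.1 := fun x => by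
    rw [norm_mul, ha, hCρ]
    exact mul_le_mul_of_nonneg_left (hρ x) (hpos x).le
  let T' : Integers K → Integers K := fun x => ⟨T (ρ x) + a (ρ x) * ((x : K) - ρ x),
    ultrametric_norm_add_le (norm_coe_integers_le _) ((hsmall x).trans (hCr x))⟩
  have hC' : IsScalingFunction r T' C := by
    refine ⟨hC.one_le, fun x y hxy => ?_⟩
    change ‖(T (ρ x) : K) + a (ρ x) * (x - ρ x) - (T (ρ y) + a (ρ y) * (y - ρ y))‖ = _
    rw [← hρeq x y hxy, add_sub_add_left_eq_sub, ← mul_sub, sub_sub_sub_cancel_right, norm_mul,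
      ha, hCρ]
  refine ⟨T', mem_mapsWithMatrix_of_norm_sub_le hT hA hC hC' fun x => ?_, hC', fun x => ?_⟩
  · change ‖(T x : K) - (T (ρ x) + a (ρ x) * (x - ρ x))‖ ≤ _
    rw [← sub_sub]
    refine ultrametric_norm_sub_le ?_ (hsmall x)
    rw [hC.norm_sub _ _ (hρ x)]
    exact mul_le_mul_of_nonneg_left (hρ x) (hpos x).le
  · refine ⟨a (ρ x), T (ρ x) - a (ρ x) * ρ x, fun y hxy => ?_⟩
    change (T (ρ y) : K) + a (ρ y) * (y - ρ y) = _
    rw [← hρeq x y hxy]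
    ring

/-- A map that is affine on cosets is approximated by a polynomial in the Lipschitz norm; the
translates of this polynomial by the elements of `B_r(0)` all have the same transition matrix. -/
theorem infinite_polynomial_mem_mapsWithMatrix {A : Matrix (Cosets r) (Cosets r) ℝ}
    (hT : IsLocallyScaling r T) (hA : hT.transitionMatrix = A) (hC : IsScalingFunction r T C)
    (haff : ∀ x : Integers K, ∃ a b : K, ∀ y : Integers K,
      ‖(x : K) - y‖ ≤ r.1 → (T y : K) = a * y + b) :
    {T | T ∈ mapsWithMatrix A ∧ IsPolynomialMap T}.Infinite := by
  have hr := hT.radius_le_one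
  have hε : 0 < min r.1 (1 / 2) := lt_min r.pos one_half_pos
  obtain ⟨p, hp⟩ := isLipLimit_of_affine_on_cosets r haff _ hε
  let B : Set K := Metric.closedBall 0 r.1
  have hB : B.Infinite :=
    infinite_of_mem_nhds (0 : K) (Metric.closedBall_mem_nhds 0 r.pos)
  have hclose : ∀ (c : B) (x : Integers K), ‖p.eval (x : K) + c - T x‖ ≤ r.1 := fun c x => by
    rw [add_sub_right_comm]
    exact ultrametric_norm_add_le ((hp.norm_le x).trans (min_le_left _ _))
      (mem_closedBall_zero_iff.mp c.2)
  have hmem : ∀ (c : B) (x : Integers K), p.eval (x : K) + c ∈ Integers K := fun c x => by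
    have := ultrametric_norm_add_le ((hclose c x).trans hr) (norm_coe_integers_le (T x))
    rwa [sub_add_cancel] at this
  let F : B → Integers K → Integers K := fun c x => ⟨p.eval (x : K) + c, hmem c x⟩
  have hF : Function.Injective F := fun c d hcd => by
    have : p.eval ((0 : Integers K) : K) + c = p.eval ((0 : Integers K) : K) + d :=
      congrArg Subtype.val (congrFun hcd 0)
    exact Subtype.ext (add_left_cancel this)
  have : Infinite B := hB.to_subtype
  refine (Set.infinite_range_of_injective hF).mono ?_
  rintro _ ⟨c, rfl⟩
  have hC' : IsScalingFunction r (F c) C := by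
    refine hC.perturb ((min_le_right r.1 (1 / 2)).trans_lt one_half_lt_one) fun x y => ?_
    convert hp.norm_sub_le x y using 2
    change p.eval (x : K) + c - T x - (p.eval (y : K) + c - T y) = _
    ring
  refine ⟨mem_mapsWithMatrix_of_norm_sub_le hT hA hC hC' fun x => ?_, p + Polynomial.C (c : K),
    fun x => ?_⟩
  · rw [norm_sub_rev]
    exact (hclose c x).trans (le_mul_of_one_le_left r.pos.le (hC.one_le x))
  · rw [eval_add, eval_C]

end LocallyScaling

/-! ### Haar measure on the balls of `𝒪` -/

section HaarIntegers

variable {K : Type*} [NontriviallyNormedField K] [IsUltrametricDist K] {π : K} {q : ℕ}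

/-- The ball of radius `|π| ^ n` around `x` in `𝒪`. -/
def integersBall (π : K) (n : ℕ) (x : Integers K) : Set (Integers K) :=
  {y | ‖(x : K) - y‖ ≤ ‖π‖ ^ n}

theorem integersBall_eq_closedBall (n : ℕ) (x : Integers K) :
    integersBall π n x = Metric.closedBall x (‖π‖ ^ n) := by
  ext y
  rw [Metric.mem_closedBall, dist_comm, dist_integers]
  rfl

theorem isPiSystem_integersBall (h : IsFrobeniusPair π q) :
    IsPiSystem {S : Set (Integers K) | ∃ n x, S = integersBall π n x} := by
  rintro _ ⟨n, x, rfl⟩ _ ⟨m, y, rfl⟩ ⟨z, hzx, hzy⟩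
  rw [integersBall_eq_closedBall] at hzx hzy
  simp only [integersBall_eq_closedBall]
  rw [IsUltrametricDist.closedBall_eq_of_mem hzx, IsUltrametricDist.closedBall_eq_of_mem hzy]
  refine ⟨max n m, z, ?_⟩
  have hanti := pow_right_anti₀ (norm_nonneg π) h.norm_lt_one.le
  rcases le_total n m with hnm | hnm
  · rw [max_eq_right hnm, Set.inter_eq_right]
    exact Metric.closedBall_subset_closedBall (hanti hnm)
  · rw [max_eq_left hnm, Set.inter_eq_left]
    exact Metric.closedBall_subset_closedBall (hanti hnm)

theorem isOpen_integersBall (h : IsFrobeniusPair π q) (n : ℕ) (x : Integers K) :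
    IsOpen (integersBall π n x) := by
  rw [integersBall_eq_closedBall]
  exact IsUltrametricDist.isOpen_closedBall x (pow_pos h.norm_pos n).ne'

variable [MeasurableSpace K] [BorelSpace K]

theorem measurableSet_integersBall (h : IsFrobeniusPair π q) (n : ℕ) (x : Integers K) :
    MeasurableSet (integersBall π n x) := (isOpen_integersBall h n x).measurableSet

variable [LocallyCompactSpace K]

theorem generateFrom_integersBall (h : IsFrobeniusPair π q) :
    (inferInstance : MeasurableSpace (Integers K))
      = MeasurableSpace.generateFrom {S | ∃ n x, S = integersBall π n x} := by
  have : SecondCountableTopology (Integers K) := secondCountable_of_proper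
  have hb : TopologicalSpace.IsTopologicalBasis
      {S : Set (Integers K) | ∃ n x, S = integersBall π n x} := by
    refine TopologicalSpace.isTopologicalBasis_of_isOpen_of_nhds ?_ fun x U hx hU => ?_
    · rintro _ ⟨n, x, rfl⟩
      exact isOpen_integersBall h n x
    · obtain ⟨ε, hε, hball⟩ := Metric.isOpen_iff.mp hU x hx
      obtain ⟨n, hn⟩ := exists_pow_lt_of_lt_one hε h.norm_lt_one
      refine ⟨_, ⟨n, x, rfl⟩, ?_, ?_⟩
      · rw [integersBall_eq_closedBall]
        exact Metric.mem_closedBall_self (pow_nonneg (norm_nonneg _) _)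
      · rw [integersBall_eq_closedBall]
        exact (Metric.closedBall_subset_ball hn).trans hball
  rw [← hb.borel_eq_generateFrom]
  exact BorelSpace.measurable_eq

instance : (haar K).IsAddHaarMeasure := by unfold haar; infer_instance

theorem haar_closedBall_one : haar K (Metric.closedBall 0 1) = 1 := by
  have h := Measure.addHaarMeasure_self (K₀ := integersCompacts K)
  rw [← coe_integers]
  exact h

theorem haarIntegers_apply (S : Set (Integers K)) :
    haarIntegers K S = haar K (Subtype.val '' S) := by
  have hO : MeasurableSet (Integers K : Set K) := by
    rw [coe_integers]; exact measurableSet_closedBall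
  exact (MeasurableEmbedding.subtype_coe hO).comap_apply _ _

instance : IsProbabilityMeasure (haarIntegers K) := by
  refine ⟨?_⟩
  rw [haarIntegers_apply, Set.image_univ, Subtype.range_coe_subtype]
  change haar K (Integers K : Set K) = 1
  rw [coe_integers, haar_closedBall_one]

open scoped Pointwise in
/-- Multiplication by `π` scales Haar measure by a constant, so that the measure of a ball of
radius `|π| ^ n` is the `n`-th power of this constant. -/
theorem exists_haarIntegers_integersBall (h : IsFrobeniusPair π q) :
    ∃ γ : ENNReal, ∀ (n : ℕ) (x : Integers K), haarIntegers K (integersBall π n x) = γ ^ n := by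
  have : ProperSpace K := ProperSpace.of_locallyCompactSpace K
  let u : Kˣ := Units.mk0 π h.ne_zero
  refine ⟨distribHaarChar K u, fun n x => ?_⟩
  have himage : (Subtype.val '' integersBall π n x : Set K)
      = Metric.closedBall (x : K) (‖π‖ ^ n) := by
    ext y
    rw [mem_closedBall_iff_norm']
    refine ⟨?_, fun hy => ?_⟩
    · rintro ⟨y, hy, rfl⟩
      exact hy
    · have hy1 := ultrametric_norm_sub_le (norm_coe_integers_le x)
        (hy.trans (pow_le_one₀ (norm_nonneg _) h.norm_lt_one.le))
      rw [sub_sub_cancel] at hy1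
      exact ⟨⟨y, hy1⟩, hy, rfl⟩
  have htrans : (fun y => (x : K) + y) ⁻¹' Metric.closedBall (x : K) (‖π‖ ^ n)
      = Metric.closedBall 0 (‖π‖ ^ n) := by
    ext y
    simp
  have hsmul : Metric.closedBall (0 : K) (‖π‖ ^ n) = (u ^ n) • Metric.closedBall (0 : K) 1 := by
    ext y
    rw [Set.mem_smul_set_iff_inv_smul_mem, mem_closedBall_zero_iff, mem_closedBall_zero_iff,
      Units.smul_def, smul_eq_mul, Units.val_inv_eq_inv_val, Units.val_pow_eq_pow_val,
      Units.val_mk0, norm_mul, norm_inv, norm_pow, inv_mul_le_one₀ (pow_pos h.norm_pos n)]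
  rw [haarIntegers_apply, himage, ← measure_preimage_add (haar K) (x : K), htrans, hsmul,
    ← distribHaarChar_mul, haar_closedBall_one, mul_one, map_pow, ENNReal.coe_pow]

/-- If `S` maps every ball of radius `|π| ^ k` onto `𝒪`, expanding distances by `|π| ^ (-k)`, then
`S ⁻¹' E` is independent of every such ball. Both sides are measures in `E`, so it is enough to
consider balls `E`; then the left side is the measure of a ball. -/
theorem haarIntegers_integersBall_inter_preimage (h : IsFrobeniusPair π q) {k : ℕ} {s : ValueSet K}
    (hs : s.1 = ‖π‖ ^ k) {S : Integers K → Integers K} (hSm : Measurable S)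
    (hS : IsScalingFunction s S fun _ => (‖π‖ ^ k)⁻¹) (x : Integers K) {E : Set (Integers K)}
    (hE : MeasurableSet E) :
    haarIntegers K (integersBall π k x ∩ S ⁻¹' E)
      = haarIntegers K (integersBall π k x) * haarIntegers K E := by
  obtain ⟨γ, hγ⟩ := exists_haarIntegers_integersBall h
  have hk : 0 < ‖π‖ ^ k := pow_pos h.norm_pos k
  have hs1 : s.1 ≤ 1 := hs ▸ pow_le_one₀ (norm_nonneg _) h.norm_lt_one.le
  have hball : ∀ n w, haarIntegers K (integersBall π k x ∩ S ⁻¹' integersBall π n w)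
      = haarIntegers K (integersBall π k x) * haarIntegers K (integersBall π n w) := by
    intro n w
    obtain ⟨y, hxy, rfl⟩ := hS.exists_eq_of_norm_sub_le hs1 x w (by
      rw [hs, inv_mul_cancel₀ hk.ne']; exact norm_coe_integers_le (w - S x))
    have e : integersBall π k x ∩ S ⁻¹' integersBall π n (S y) = integersBall π (k + n) y := by
      rw [hs] at hxy
      have hle : ‖π‖ ^ (k + n) ≤ ‖π‖ ^ k :=
        pow_le_pow_of_le_one (norm_nonneg _) h.norm_lt_one.le (Nat.le_add_right _ _)
      have key : ∀ z : Integers K, ‖(y : K) - z‖ ≤ ‖π‖ ^ k →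
          (‖(S y : K) - S z‖ ≤ ‖π‖ ^ n ↔ ‖(y : K) - z‖ ≤ ‖π‖ ^ (k + n)) := fun z hz => by
        rw [hS.norm_sub y z (hs ▸ hz), inv_mul_le_iff₀ hk, pow_add]
      ext z
      refine ⟨fun ⟨hz, hSz⟩ => ?_, fun hz => ?_⟩
      · have hyz : ‖(y : K) - z‖ ≤ ‖π‖ ^ k := by
          have := ultrametric_norm_sub_le hz hxy
          rwa [sub_sub_sub_cancel_left] at this
        exact (key z hyz).mp hSz
      · have hyz : ‖(y : K) - z‖ ≤ ‖π‖ ^ k := hz.trans hle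
        refine ⟨?_, (key z hyz).mpr hz⟩
        have := ultrametric_norm_add_le hxy hyz
        rwa [sub_add_sub_cancel] at this
    rw [e, hγ, hγ, hγ, pow_add]
  have hm := measurableSet_integersBall h k x
  have heq : ((haarIntegers K).restrict (integersBall π k x)).map S
      = haarIntegers K (integersBall π k x) • haarIntegers K := by
    refine ext_of_generate_finite _ (generateFrom_integersBall h) (isPiSystem_integersBall h) ?_ ?_
    · rintro _ ⟨n, w, rfl⟩
      have hw := measurableSet_integersBall h n w
      rw [Measure.map_apply hSm hw, Measure.restrict_apply (hSm hw), Set.inter_comm, hball]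
      rfl
    · rw [Measure.map_apply hSm .univ, Set.preimage_univ, Measure.restrict_apply .univ,
        Set.univ_inter, Measure.smul_apply, measure_univ, smul_eq_mul, mul_one]
  have := congrArg (fun μ => μ E) heq
  rwa [Measure.map_apply hSm hE, Measure.restrict_apply (hSm hE), Set.inter_comm] at this

end HaarIntegers

/-! ### The mixing polynomial map `x ↦ (x ^ q - x) / π` -/

section FrobeniusMap

variable {K : Type*} [NontriviallyNormedField K] [IsUltrametricDist K] {π : K} {q : ℕ}

/-- The map `x ↦ (x ^ q - x) / π` on `𝒪`. -/
def frobeniusMap (h : IsFrobeniusPair π q) (x : Integers K) : Integers K :=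
  ⟨((x : K) ^ q - x) / π, by
    rw [mem_integers, norm_div]
    exact div_le_one_of_le₀ (h.norm_pow_sub_le x (norm_coe_integers_le x)) (norm_nonneg _)⟩

theorem coe_frobeniusMap (h : IsFrobeniusPair π q) (x : Integers K) :
    (frobeniusMap h x : K) = ((x : K) ^ q - x) / π := rfl

theorem isPolynomialMap_frobeniusMap (h : IsFrobeniusPair π q) :
    IsPolynomialMap (frobeniusMap h) :=
  ⟨C π⁻¹ * (X ^ q - X), fun x => by simp [coe_frobeniusMap, div_eq_inv_mul]⟩

theorem continuous_frobeniusMap (h : IsFrobeniusPair π q) : Continuous (frobeniusMap h) :=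
  Continuous.subtype_mk (by fun_prop) _

/-- The term `(x ^ q - y ^ q) / π` has absolute value at most `|x - y|`, so `(x - y) / π`
dominates. -/
theorem norm_frobeniusMap_sub (h : IsFrobeniusPair π q) {x y : Integers K}
    (hxy : ‖(x : K) - y‖ ≤ ‖π‖) :
    ‖(frobeniusMap h x : K) - frobeniusMap h y‖ = ‖π‖⁻¹ * ‖(x : K) - y‖ := by
  by_cases hne : x = y
  · simp [hne]
  have hpos : 0 < ‖(x : K) - y‖ :=
    norm_pos_iff.mpr (sub_ne_zero.mpr fun h' => hne (Subtype.ext h'))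
  have e : (frobeniusMap h x : K) - frobeniusMap h y
      = π⁻¹ * ((x : K) ^ q - (y : K) ^ q - (x - y)) := by
    rw [coe_frobeniusMap, coe_frobeniusMap]
    ring
  have hlt : ‖(x : K) ^ q - (y : K) ^ q - (x - y) - -(x - y)‖ < ‖-((x : K) - y)‖ := by
    rw [sub_neg_eq_add, sub_add_cancel, norm_neg]
    exact (h.norm_pow_sub_pow_le (norm_coe_integers_le x) (norm_coe_integers_le y) hxy).trans_lt
      (mul_lt_of_lt_one_left hpos h.norm_lt_one)
  rw [e, norm_mul, norm_inv, norm_eq_of_norm_sub_lt hlt, norm_neg]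

/-- `|π| ^ k`, as an element of the value set. -/
def IsFrobeniusPair.radius (h : IsFrobeniusPair π q) (k : ℕ) : ValueSet K :=
  ⟨‖π‖ ^ k, π ^ k, pow_ne_zero _ h.ne_zero, norm_pow _ _⟩

theorem isScalingFunction_iterate_frobeniusMap (h : IsFrobeniusPair π q) (k : ℕ) :
    IsScalingFunction (h.radius k) (frobeniusMap h)^[k] fun _ => (‖π‖ ^ k)⁻¹ := by
  refine ⟨fun _ => (one_le_inv₀ (pow_pos h.norm_pos k)).mpr
    (pow_le_one₀ (norm_nonneg _) h.norm_lt_one.le), fun x y hxy => ?_⟩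
  change ‖(x : K) - y‖ ≤ ‖π‖ ^ k at hxy
  induction k generalizing x y with
  | zero => simp
  | succ k ih =>
    have h1 : ‖(x : K) - y‖ ≤ ‖π‖ :=
      hxy.trans (pow_le_of_le_one (norm_nonneg _) h.norm_lt_one.le k.succ_ne_zero)
    have h2 := norm_frobeniusMap_sub h h1
    rw [Function.iterate_succ_apply, Function.iterate_succ_apply, ih, h2, pow_succ, mul_inv,
      mul_assoc]
    rw [h2, inv_mul_le_iff₀ h.norm_pos, ← pow_succ']
    exact hxy

variable [LocallyCompactSpace K] [MeasurableSpace K] [BorelSpace K]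

theorem haarIntegers_integersBall_inter_preimage_frobeniusMap (h : IsFrobeniusPair π q) (k : ℕ)
    (x : Integers K) {E : Set (Integers K)} (hE : MeasurableSet E) :
    haarIntegers K (integersBall π k x ∩ (frobeniusMap h)^[k] ⁻¹' E)
      = haarIntegers K (integersBall π k x) * haarIntegers K E :=
  haarIntegers_integersBall_inter_preimage h (s := h.radius k) rfl
    ((continuous_frobeniusMap h).iterate k).measurable
    (isScalingFunction_iterate_frobeniusMap h k) x hE

theorem measurePreserving_frobeniusMap (h : IsFrobeniusPair π q) :
    MeasurePreserving (frobeniusMap h) (haarIntegers K) (haarIntegers K) := by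
  have hm : Measurable (frobeniusMap h) := (continuous_frobeniusMap h).measurable
  refine ⟨hm, Measure.ext fun E hE => ?_⟩
  rw [Measure.map_apply hm hE]
  let x₀ : Cosets (h.radius 1) → Integers K := Quotient.out
  have hfib : ∀ i : Cosets (h.radius 1),
      toCoset (h.radius 1) ⁻¹' {i} = integersBall π 1 (x₀ i) := fun i => by
    ext y
    have hi : toCoset (h.radius 1) (x₀ i) = i := Quotient.out_eq i
    rw [Set.mem_preimage, Set.mem_singleton_iff, eq_comm, ← hi, toCoset_eq_iff, hi]
    rfl
  have hsum : ∀ A : Set (Integers K),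
      haarIntegers K A = ∑ i, haarIntegers K (integersBall π 1 (x₀ i) ∩ A) := fun A => by
    have hmi : ∀ i, MeasurableSet (toCoset (h.radius 1) ⁻¹' {i}) := fun i => by
      rw [hfib]; exact measurableSet_integersBall h 1 _
    have := sum_measure_preimage_singleton (μ := (haarIntegers K).restrict A) Finset.univ
      (f := toCoset (h.radius 1)) fun i _ => hmi i
    rw [Finset.coe_univ, Set.preimage_univ, Measure.restrict_apply_univ] at this
    rw [← this]
    exact Finset.sum_congr rfl fun i _ => by rw [Measure.restrict_apply (hmi i), hfib]
  have hone : ∑ i, haarIntegers K (integersBall π 1 (x₀ i)) = 1 := by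
    rw [← measure_univ (μ := haarIntegers K), hsum Set.univ]
    simp only [Set.inter_univ]
  rw [hsum, ← one_mul (haarIntegers K E), ← hone, Finset.sum_mul]
  exact Finset.sum_congr rfl fun i _ =>
    haarIntegers_integersBall_inter_preimage_frobeniusMap h 1 _ hE

/-- For a ball `F`, the sets `T^[n] ⁻¹' E` and `F` are independent as soon as `n` is large. The
sets `F` for which the mixing property holds form a λ-system. -/
theorem isMixing_frobeniusMap (h : IsFrobeniusPair π q) :
    IsMixing (haarIntegers K) (frobeniusMap h) := by
  intro E F hE hF
  have hpres : ∀ n, haarIntegers K ((frobeniusMap h)^[n] ⁻¹' E) = haarIntegers K E := fun n =>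
    ((measurePreserving_frobeniusMap h).iterate n).measure_preimage hE.nullMeasurableSet
  have hmeas : ∀ n, MeasurableSet ((frobeniusMap h)^[n] ⁻¹' E) := fun n =>
    ((continuous_frobeniusMap h).iterate n).measurable hE
  induction F, hF using MeasurableSpace.induction_on_inter (generateFrom_integersBall h)
    (isPiSystem_integersBall h) with
  | empty => simp
  | basic F hF =>
    obtain ⟨k, x, rfl⟩ := hF
    refine tendsto_const_nhds.congr' ?_
    filter_upwards [eventually_ge_atTop k] with n hn
    obtain ⟨m, rfl⟩ := Nat.exists_eq_add_of_le' hn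
    rw [Function.iterate_add, Set.preimage_comp, Set.inter_comm,
      haarIntegers_integersBall_inter_preimage_frobeniusMap h k x (hmeas m), hpres, mul_comm]
  | compl F hF ih =>
    have e : ∀ n, haarIntegers K ((frobeniusMap h)^[n] ⁻¹' E ∩ Fᶜ)
        = haarIntegers K E - haarIntegers K ((frobeniusMap h)^[n] ⁻¹' E ∩ F) := fun n => by
      rw [← hpres n, ← Set.sdiff_eq, ← Set.sdiff_inter_self_eq_sdiff, Set.inter_comm F,
        measure_sdiff Set.inter_subset_left ((hmeas n).inter hF).nullMeasurableSet
          (measure_ne_top _ _)]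
    simp only [e]
    rw [prob_compl_eq_one_sub hF, ENNReal.mul_sub fun _ _ => measure_ne_top _ _, mul_one]
    exact ENNReal.Tendsto.sub tendsto_const_nhds ih (.inl (measure_ne_top _ _))
  | iUnion f hd hf ih =>
    have e : ∀ n, haarIntegers K ((frobeniusMap h)^[n] ⁻¹' E ∩ ⋃ i, f i)
        = ∫⁻ i, haarIntegers K ((frobeniusMap h)^[n] ⁻¹' E ∩ f i) ∂Measure.count := fun n => by
      rw [lintegral_count, Set.inter_iUnion, measure_iUnion
        (fun i j hij => (hd hij).mono Set.inter_subset_right Set.inter_subset_right)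
        fun i => (hmeas n).inter (hf i)]
    have e' : haarIntegers K E * haarIntegers K (⋃ i, f i)
        = ∫⁻ i, haarIntegers K E * haarIntegers K (f i) ∂Measure.count := by
      rw [lintegral_count, ENNReal.tsum_mul_left, measure_iUnion hd hf]
    simp only [e]
    rw [e']
    refine tendsto_lintegral_of_dominated_convergence (fun i => haarIntegers K (f i))
      (fun _ => .of_discrete) (fun n => .of_forall fun i => measure_mono Set.inter_subset_right) ?_
      (.of_forall ih)
    rw [lintegral_count, ← measure_iUnion hd hf]
    exact measure_ne_top _ _

end FrobeniusMap

end NALocalField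

open NALocalField in
theorem mainTheorem3 (K : Type*) [NontriviallyNormedField K] [IsUltrametricDist K]
    [LocallyCompactSpace K] [MeasurableSpace K] [BorelSpace K] :
    (∀ (r : ValueSet K) (A : Matrix (Cosets r) (Cosets r) ℝ),
      A ∈ Matrix.rowStochastic ℝ (Cosets r) → (mapsWithMatrix A).Nonempty →
        (∃ T ∈ mapsWithMatrix A, IsLocallyAffine T) ∧
        {T | T ∈ mapsWithMatrix A ∧ IsPolynomialMap T}.Infinite) ∧
    (∃ T : Integers K → Integers K, IsPolynomialMap T ∧ (∃ r, IsLocallyScaling r T) ∧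
      MeasurePreserving T (haarIntegers K) (haarIntegers K) ∧ IsMixing (haarIntegers K) T) := by
  constructor
  · rintro r A - ⟨T, hT, hA⟩
    obtain ⟨C, hC⟩ := hT.exists_scaling
    obtain ⟨T', ⟨hT', hA'⟩, hC', haff⟩ := exists_locallyAffine_mem_mapsWithMatrix hT hA hC
    exact ⟨⟨T', ⟨hT', hA'⟩, fun x => ⟨r, haff x⟩⟩,
      infinite_polynomial_mem_mapsWithMatrix hT' hA' hC' haff⟩
  · obtain ⟨π, q, h⟩ := exists_isFrobeniusPair K
    refine ⟨frobeniusMap h, isPolynomialMap_frobeniusMap h, ⟨h.radius 1, ?_⟩,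
      measurePreserving_frobeniusMap h, isMixing_frobeniusMap h⟩
    exact isLocallyScaling_of_isScalingFunction
      (pow_le_one₀ (norm_nonneg _) h.norm_lt_one.le) (isScalingFunction_iterate_frobeniusMap h 1)
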